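/- Let $K$ be a strong semiring, i.e. a Hausdorff topological semiring in which the product $(x_iy_j)_{(i,j)}$ of two summable families is summable; $k\in K$ is starrable if $k^*=\sum_{n\ge 0}k^n$ exists. Let $M$ be a graded monoid: it has an additive length that is positive on every element different from $1$, and each element has finitely many factorisations, so that the Cauchy product of series $M\to K$ is defined. $K$-expressions over $M$ are the formulas $$\mathsf E ::= \mathsf 0\mid \mathsf 1\mid m\ (m\in M\setminus\{1\})\mid k\,\mathsf E\mid \mathsf E\,k\ (k\in K)\mid \mathsf E+\mathsf E\mid \mathsf E\cdot\mathsf E\mid \mathsf E^*,$$ equality being equality of formulas. The constant term $c(\mathsf E)\in K$ is given by $c(\mathsf 0)=c(m)=0$, $c(\mathsf 1)=1$, $c(k\mathsf E)=k\,c(\mathsf E)$, $c(\mathsf Ek)=c(\mathsf E)k$, $c(\mathsf F+\mathsf G)=c(\mathsf F)+c(\mathsf G)$, $c(\mathsf F\cdot\mathsf G)=c(\mathsf F)c(\mathsf G)$, $c(\mathsf F^*)=c(\mathsf F)^*$; $\mathsf E$ is valid if $c(\mathsf F)$ is starrable for every subexpression $\mathsf F^*$ of $\mathsf E$. The series $|\mathsf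 E|$ denoted by $\mathsf E$ is obtained by interpreting the operators in the semiring of series $M\to K$ with the topology of simple convergence. A finite automaton $\mathcal A=\langle I,E,T\rangle$ has a finite set of states $Q$, $I,T\in K^Q$, and $E$ a $Q\times Q$-matrix of finite $K$-linear combinations of elements of $M\setminus\{1\}$; its behaviour is $I\,E^*\,T$. A surjective map $\varphi\colon Q\to R$ is a morphism from $\langle I,E,T\rangle$ onto $\langle J,F,U\rangle$ if $IX=J$, $EX=XF$ and $T=XU$, where $X_{q,r}=1$ if $\varphi(q)=r$ and $X_{q,r}=0$ otherwise; the second automaton is then a quotient of the first, and $\varphi$ merges two states if it gives them the same image. The image $\varphi(\mathcal A)$ is $\langle IX,YEX,YT\rangle$, where $Y$ is an $R\times Q$-matrix whose row of index $r$ is the unit vector of one chosen state of $\varphi^{-1}(r)$ (when $\varphi$ is a morphism onto $\varphi(\mathcal A)$, the choice does not matter). A standard automaton of dimension $P$ has states $\{i\}\sqcup P$ and is written $(c;J;F;U)$: the initial state $i$ has initial weight $1$ and final weight $c$, no transition enters $i$, $J$ is the row of transitions from $i$ to $P$, $F$ the matrix of transitions within $P$, $U$ the final weights on $P$, and all other initial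 weights are $0$. For $\mathcal A=(c;J;F;U)$ and $\mathcal B=(d;K;G;V)$ put $k\mathcal A=(kc;kJ;F;U)$, $\mathcal Ak=(ck;J;F;Uk)$, $\mathcal A+\mathcal B=\left(c+d;(J,K);\begin{pmatrix}F&0\\0&G\end{pmatrix};\begin{pmatrix}U\\V\end{pmatrix}\right)$, $\mathcal A\cdot\mathcal B=\left(cd;(J,cK);\begin{pmatrix}F&UK\\0&G\end{pmatrix};\begin{pmatrix}Ud\\V\end{pmatrix}\right)$ and $\mathcal A^*=(c^*;c^*J;Uc^*J+F;Uc^*)$. The position automaton $\mathcal S_{\mathsf E}$ is obtained by applying these operations along the formation of $\mathsf E$, starting from $\mathcal S_{\mathsf 0}$ and $\mathcal S_{\mathsf 1}$, of dimension $\emptyset$ with $c=0$ and $c=1$ respectively, and $\mathcal S_m=(0;(m);(0);(1))$ with one non-initial state. The finite set $\mathrm D(\mathsf E)$ of derived terms of $\mathsf E$ is defined by $\mathrm D(\mathsf 0)=\mathrm D(\mathsf 1)=\emptyset$, $\mathrm D(m)=\{\mathsf 1\}$, $\mathrm D(k\mathsf F)=\mathrm D(\mathsf F)$, $\mathrm D(\mathsf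 Fk)=\mathrm D(\mathsf F)k$, $\mathrm D(\mathsf F+\mathsf G)=\mathrm D(\mathsf F)\cup\mathrm D(\mathsf G)$, $\mathrm D(\mathsf F\cdot\mathsf G)=\mathrm D(\mathsf F)\cdot\mathsf G\cup\mathrm D(\mathsf G)$, $\mathrm D(\mathsf F^*)=\mathrm D(\mathsf F)\cdot\mathsf F^*$, where $\mathrm D(\mathsf F)k=\{\mathsf Hk:\mathsf H\in\mathrm D(\mathsf F)\}$ and $\mathrm D(\mathsf F)\cdot\mathsf G=\{\mathsf H\cdot\mathsf G:\mathsf H\in\mathrm D(\mathsf F)\}$. The standard automaton $\mathcal T_{\mathsf E}$, of dimension $\mathrm D(\mathsf E)$, is built in the same way as $\mathcal S_{\mathsf E}$, the states being renamed accordingly, except that $\mathcal T_{\mathsf F+\mathsf G}$ and $\mathcal T_{\mathsf F\cdot\mathsf G}$ are the images of $\mathcal T_{\mathsf F}+\mathcal T_{\mathsf G}$ and $\mathcal T_{\mathsf F}\cdot\mathcal T_{\mathsf G}$ by the natural maps $\mathrm D(\mathsf F)\sqcup\mathrm D(\mathsf G)\to\mathrm D(\mathsf F)\cup\mathrm D(\mathsf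 G)$ and $\mathrm D(\mathsf F)\cdot\mathsf G\sqcup\mathrm D(\mathsf G)\to\mathrm D(\mathsf F)\cdot\mathsf G\cup\mathrm D(\mathsf G)$, the initial state being kept apart. Let the initial state of $\mathcal T_{\mathsf E}$ be indexed by $\mathsf E$, let $\omega\colon\{\mathsf E\}\sqcup\mathrm D(\mathsf E)\to\{\mathsf E\}\cup\mathrm D(\mathsf E)$ be the natural map, and let the derived-term automaton of $\mathsf E$ be $\mathcal D_{\mathsf E}=\omega(\mathcal T_{\mathsf E})$. **Theorem.** For every valid $K$-expression $\mathsf E$ over $M$: 1. $\mathcal D_{\mathsf E}$ is a quotient of the position automaton $\mathcal S_{\mathsf E}$; 2. hence the series $|\mathsf E|$ is defined (all the stars in its definition exist) and $\mathcal D_{\mathsf E}$ realises it, i.e. the behaviour of $\mathcal D_{\mathsf E}$ is $|\mathsf E|$; 3. $\omega$ is a morphism from $\mathcal T_{\mathsf E}$ onto $\mathcal D_{\mathsf E}$; if $\mathsf E\in\mathrm D(\mathsf E)$ it merges the initial state with the state $\mathsf E$ and merges no other two distinct states, and if $\mathsf E\notin\mathrm D(\mathsf E)$ it is a bijection, so that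 $\mathcal D_{\mathsf E}$ is $\mathcal T_{\mathsf E}$. -/

import Mathlib

/-!
Weighted rational expressions over a graded monoid `M` with weights in a strong topological
semiring `K`, their standard (position) automata and their derived-term automata.
-/

noncomputable section

namespace WExpr

universe u v

/-- A *strong* semiring: a (Hausdorff) topological semiring in which the product of two summable
families is a summable family. -/
class IsStrongSemiring (K : Type u) [Semiring K] [TopologicalSpace K] : Prop extends
    IsTopologicalSemiring K, T2Space K where
  summable_mul : ∀ {ι κ : Type} (x : ι → K) (y : κ → K), Summable x → Summable y →
    Summable (fun p : ι × κ => x p.1 * y p.2)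

/-- A *graded* monoid: there is an additive length which is positive on the elements different
from `1`, and every element has finitely many factorisations (so that the Cauchy product of
arbitrary series over the monoid is defined; this holds as soon as the graded monoid is finitely
generated, or is a free monoid). -/
class IsGradedMonoid (M : Type v) [Monoid M] : Prop where
  exists_length : ∃ len : M → ℕ, (∀ a b, len (a * b) = len a + len b) ∧ ∀ a, a ≠ 1 → 0 < len a
  finite_factorisations : ∀ m : M, {p : M × M | p.1 * p.2 = m}.Finite

/-! ### Starrable elements -/

section Star

variable {K : Type u} [Semiring K] [TopologicalSpace K]

/-- `k` is starrable if the family of its powers is summable. -/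
def Starrable (k : K) : Prop := Summable (fun n : ℕ => k ^ n)

/-- `k*`, the sum of all powers of `k` (meaningful if `k` is starrable). -/
def kstar (k : K) : K := ∑' n : ℕ, k ^ n

end Star

/-! ### Series, with the topology of simple convergence -/

/-- Series over `M` with coefficients in `K`: maps from `M` to `K`.  The (product) topology, the
zero, the addition and the summable families of `M → K` are the pointwise ones. -/
abbrev Series (K : Type u) (M : Type v) : Type (max u v) := M → K

namespace Series

variable {K : Type u} {M : Type v} [Semiring K] [Monoid M]

open Classical in
/-- The series `m`, for an element `m` of the monoid; `mono 1` is the unit series. -/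
def mono (m : M) : Series K M := fun x => if x = m then 1 else 0

/-- The Cauchy product of series. -/
def cauchy [IsGradedMonoid M] (s t : Series K M) : Series K M := fun m =>
  ∑ p ∈ (IsGradedMonoid.finite_factorisations m).toFinset, s p.1 * t p.2

/-- Powers of a series for the Cauchy product. -/
def pow [IsGradedMonoid M] (s : Series K M) : ℕ → Series K M
  | 0 => mono 1
  | n + 1 => cauchy (pow s n) s

/-- A series is starrable if the family of its powers is summable. -/
def Starrable [TopologicalSpace K] [IsGradedMonoid M] (s : Series K M) : Prop :=
  Summable (fun n : ℕ => pow s n)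

/-- The star of a series: the sum of its powers (meaningful if the series is starrable). -/
def star [TopologicalSpace K] [IsGradedMonoid M] (s : Series K M) : Series K M :=
  ∑' n : ℕ, pow s n

end Series

/-! ### Expressions -/

/-- Rational expressions over `M` with weights in `K` (`K`-expressions). -/
inductive Expr (K : Type u) (M : Type v) [Monoid M] : Type (max u v)
  | zero : Expr K M
  | one : Expr K M
  | atom (m : M) (hm : m ≠ 1) : Expr K M
  | lsmul (k : K) (E : Expr K M) : Expr K M
  | rsmul (E : Expr K M) (k : K) : Expr K M
  | add (E F : Expr K M) : Expr K M
  | mul (E F : Expr K M) : Expr K M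
  | star (E : Expr K M) : Expr K M

namespace Expr

variable {K : Type u} {M : Type v} [Semiring K] [TopologicalSpace K] [Monoid M]

/-- The constant term of an expression (meaningful if the expression is valid). -/
def constTerm : Expr K M → K
  | zero => 0
  | one => 1
  | atom _ _ => 0
  | lsmul k E => k * constTerm E
  | rsmul E k => constTerm E * k
  | add E F => constTerm E + constTerm F
  | mul E F => constTerm E * constTerm F
  | star E => kstar (constTerm E)

/-- An expression is valid if the constant term of every starred subexpression is starrable. -/
def Valid : Expr K M → Prop
  | zero => True
  | one => True
  | atom _ _ => True
  | lsmul _ E => Valid E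
  | rsmul E _ => Valid E
  | add E F => Valid E ∧ Valid F
  | mul E F => Valid E ∧ Valid F
  | star E => Valid E ∧ Starrable (constTerm E)

/-- The series denoted by an expression (meaningful if `SeriesDefined` holds). -/
def series [IsGradedMonoid M] : Expr K M → Series K M
  | zero => 0
  | one => Series.mono 1
  | atom m _ => Series.mono m
  | lsmul k E => fun x => k * series E x
  | rsmul E k => fun x => series E x * k
  | add E F => series E + series F
  | mul E F => Series.cauchy (series E) (series F)
  | star E => Series.star (series E)

/-- All the stars that occur in the definition of the series denoted by an expression exist. -/
def SeriesDefined [IsGradedMonoid M] : Expr K M → Prop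
  | zero => True
  | one => True
  | atom _ _ => True
  | lsmul _ E => SeriesDefined E
  | rsmul E _ => SeriesDefined E
  | add E F => SeriesDefined E ∧ SeriesDefined F
  | mul E F => SeriesDefined E ∧ SeriesDefined F
  | star E => SeriesDefined E ∧ Series.Starrable (series E)

end Expr

/-! ### Automata -/

/-- A finite `K`-automaton over `M` with (finite) set of states `Q`, in matrix form: an initial
row-vector, a final column-vector, and a transition matrix whose entries are finite linear
combinations of elements of `M` different from `1`. -/
structure Automaton (K : Type u) (M : Type v) [Semiring K] [Monoid M] (Q : Type*) where
  init : Q → K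
  trans : Matrix Q Q (MonoidAlgebra K M)
  final : Q → K
  proper : ∀ p q, (trans p q).coeff 1 = 0

/-- The amalgamation matrix of a map `φ`. -/
def amalgamation (K : Type u) [Semiring K] {Q R : Type*} (φ : Q → R) : Matrix Q R K :=
  open Classical in Matrix.of fun q r => if φ q = r then 1 else 0

namespace Automaton

variable {K : Type u} {M : Type v} [Semiring K] [Monoid M]

open Classical in
/-- The star of the transition matrix: the sum of its powers (coefficientwise). -/
def transStar [TopologicalSpace K] {Q : Type*} [Fintype Q] (A : Automaton K M Q) :
    Matrix Q Q (Series K M) :=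
  Matrix.of fun p q m => ∑' n : ℕ, ((A.trans ^ n) p q).coeff m

/-- The behaviour `I · E* · T` of an automaton. -/
def behaviour [TopologicalSpace K] {Q : Type*} [Fintype Q] (A : Automaton K M Q) :
    Series K M :=
  fun m => ∑ p, ∑ q, A.init p * A.transStar p q m * A.final q

/-- `A` is conjugate to `B` with transfer matrix `X`:  `I X = J`, `E X = X F`, `T = X U`.
(Scalars are seen as polynomials supported by `1` in the second equation.) -/
def ConjugateBy {Q R : Type*} [Fintype Q] [Fintype R] (A : Automaton K M Q)
    (B : Automaton K M R) (X : Matrix Q R K) : Prop :=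
  Matrix.vecMul A.init X = B.init ∧
  A.trans * X.map (MonoidAlgebra.singleOneRingHom : K →+* MonoidAlgebra K M) =
    X.map (MonoidAlgebra.singleOneRingHom : K →+* MonoidAlgebra K M) * B.trans ∧
  A.final = Matrix.mulVec X B.final

/-- A surjective map on states is a morphism from `A` onto `B` if `A` is conjugate to `B` by its
amalgamation matrix. -/
def IsMorphism {Q R : Type*} [Fintype Q] [Fintype R] (A : Automaton K M Q)
    (B : Automaton K M R) (φ : Q → R) : Prop :=
  Function.Surjective φ ∧ A.ConjugateBy B (amalgamation K φ)

/-- `B` is a quotient of `A` if there is a morphism from `A` onto `B`. -/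
def IsQuotient {Q R : Type*} [Fintype Q] [Fintype R] (B : Automaton K M R)
    (A : Automaton K M Q) : Prop :=
  ∃ φ : Q → R, A.IsMorphism B φ

open Classical in
/-- The image `⟨I X, Y E X, Y T⟩` of an automaton by a surjective map `φ`, where `X` is the
amalgamation matrix of `φ` and `Y` is a selection matrix (its row of index `r` selects one state
of the class of `r`).  It does not depend on the selection when `φ` is a morphism. -/
def image {Q R : Type*} [Fintype Q] (A : Automaton K M Q) (φ : Q → R)
    (hφ : Function.Surjective φ) : Automaton K M R where
  init r := ∑ q with φ q = r, A.init q
  trans := Matrix.of fun r r' => ∑ q with φ q = r', A.trans (Function.surjInv hφ r) q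
  final r := A.final (Function.surjInv hφ r)
  proper r r' := by
    simp [MonoidAlgebra.coeff_sum, A.proper]

end Automaton

/-! ### Standard automata and the operations on them -/

/-- A standard automaton of dimension `ι` in block form `⟨(1 0), (0 J; 0 F), (c; U)⟩`. -/
structure StdAut (K : Type u) (M : Type v) [Semiring K] [Monoid M] (ι : Type*) where
  c : K
  J : ι → MonoidAlgebra K M
  F : Matrix ι ι (MonoidAlgebra K M)
  U : ι → K
  properJ : ∀ q, (J q).coeff 1 = 0
  properF : ∀ p q, (F p q).coeff 1 = 0

namespace StdAut

variable {K : Type u} {M : Type v} [Semiring K] [Monoid M]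

/-- The automaton described by the block form; its initial state is `Sum.inl ()`. -/
def toAutomaton {ι : Type*} (A : StdAut K M ι) : Automaton K M (Unit ⊕ ι) where
  init := Sum.elim (fun _ => 1) (fun _ => 0)
  trans := Matrix.fromBlocks 0 (Matrix.of fun _ q => A.J q) 0 A.F
  final := Sum.elim (fun _ => A.c) A.U
  proper := by
    rintro (p | p) (q | q) <;> simp [A.properJ, A.properF]

/-- The one-state automaton with final weight `c` and no transition. -/
def const (c : K) : StdAut K M Empty where
  c := c
  J := Empty.elim
  F := 0
  U := Empty.elim
  properJ q := q.elim
  properF p := p.elim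

/-- The two-state automaton with a single transition, labelled by `m ≠ 1`; `ι` is a one-point
type. -/
def single (ι : Type*) (m : M) (hm : m ≠ 1) : StdAut K M ι where
  c := 0
  J _ := MonoidAlgebra.single m 1
  F := 0
  U _ := 1
  properJ _ := by simp [hm]
  properF _ _ := by simp

/-- `k A` -/
def lsmul {ι : Type*} (k : K) (A : StdAut K M ι) : StdAut K M ι where
  c := k * A.c
  J q := k • A.J q
  F := A.F
  U := A.U
  properJ q := by simp [A.properJ]
  properF := A.properF

/-- `A k` -/
def rsmul {ι : Type*} (A : StdAut K M ι) (k : K) : StdAut K M ι where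
  c := A.c * k
  J := A.J
  F := A.F
  U q := A.U q * k
  properJ := A.properJ
  properF := A.properF

/-- `A + B` -/
def add {ι κ : Type*} (A : StdAut K M ι) (B : StdAut K M κ) : StdAut K M (ι ⊕ κ) where
  c := A.c + B.c
  J := Sum.elim A.J B.J
  F := Matrix.fromBlocks A.F 0 0 B.F
  U := Sum.elim A.U B.U
  properJ := by rintro (q | q) <;> simp [A.properJ, B.properJ]
  properF := by rintro (p | p) (q | q) <;> simp [A.properF, B.properF]

/-- `A · B` -/
def mul {ι κ : Type*} (A : StdAut K M ι) (B : StdAut K M κ) : StdAut K M (ι ⊕ κ) where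
  c := A.c * B.c
  J := Sum.elim A.J (fun q => A.c • B.J q)
  F := Matrix.fromBlocks A.F (Matrix.of fun p q => A.U p • B.J q) 0 B.F
  U := Sum.elim (fun p => A.U p * B.c) B.U
  properJ := by rintro (q | q) <;> simp [A.properJ, B.properJ]
  properF := by rintro (p | p) (q | q) <;> simp [A.properF, B.properF, B.properJ]

/-- `A*` (meaningful if `A.c` is starrable) -/
def star [TopologicalSpace K] {ι : Type*} (A : StdAut K M ι) : StdAut K M ι where
  c := kstar A.c
  J q := kstar A.c • A.J q
  F := Matrix.of fun p q => (A.U p * kstar A.c) • A.J q + A.F p q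
  U q := A.U q * kstar A.c
  properJ q := by simp [A.properJ]
  properF p q := by simp [A.properJ, A.properF]

open Classical in
/-- The image of a standard automaton by a surjective map on its non-initial states (the initial
state being mapped to the initial state).  If the map is bijective, this is only a renaming of the
states. -/
def image {ι κ : Type*} [Fintype ι] (A : StdAut K M ι) (φ : ι → κ)
    (hφ : Function.Surjective φ) : StdAut K M κ where
  c := A.c
  J r := ∑ q with φ q = r, A.J q
  F := Matrix.of fun r r' => ∑ q with φ q = r', A.F (Function.surjInv hφ r) q
  U r := A.U (Function.surjInv hφ r)
  properJ r := by simp [MonoidAlgebra.coeff_sum, A.properJ]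
  properF r r' := by simp [MonoidAlgebra.coeff_sum, A.properF]

end StdAut

namespace Expr

section

variable {K : Type u} {M : Type v} [Semiring K] [TopologicalSpace K] [Monoid M]

/-! ### The position automaton of an expression -/

/-- The positions of an expression: the occurrences of its atoms. -/
def Pos : Expr K M → Type
  | zero => Empty
  | one => Empty
  | atom _ _ => Unit
  | lsmul _ E => Pos E
  | rsmul E _ => Pos E
  | add E F => Pos E ⊕ Pos F
  | mul E F => Pos E ⊕ Pos F
  | star E => Pos E

/-- An expression has finitely many positions. -/
@[reducible] def posFintype : (E : Expr K M) → Fintype (Pos E)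
  | zero => inferInstanceAs (Fintype Empty)
  | one => inferInstanceAs (Fintype Empty)
  | atom _ _ => inferInstanceAs (Fintype Unit)
  | lsmul _ E => posFintype E
  | rsmul E _ => posFintype E
  | add E F => @instFintypeSum _ _ (posFintype E) (posFintype F)
  | mul E F => @instFintypeSum _ _ (posFintype E) (posFintype F)
  | star E => posFintype E

instance (E : Expr K M) : Fintype (Pos E) := posFintype E

/-- The standard automaton (position automaton) of an expression, in block form. -/
def standard : (E : Expr K M) → StdAut K M (Pos E)
  | zero => StdAut.const 0
  | one => StdAut.const 1
  | atom m hm => StdAut.single Unit m hm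
  | lsmul k E => (standard E).lsmul k
  | rsmul E k => (standard E).rsmul k
  | add E F => (standard E).add (standard F)
  | mul E F => (standard E).mul (standard F)
  | star E => (standard E).star

/-- The standard automaton (position automaton) of an expression. -/
def positionAutomaton (E : Expr K M) : Automaton K M (Unit ⊕ Pos E) :=
  (standard E).toAutomaton

end

section

variable {K : Type u} {M : Type v} [Monoid M]

/-! ### The derived terms of an expression -/

open Classical in
/-- The (finite) set of derived terms of an expression. -/
def derTerms : Expr K M → Finset (Expr K M)
  | zero => ∅
  | one => ∅
  | atom _ _ => {one}
  | lsmul _ F => derTerms F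
  | rsmul F k => (derTerms F).image (fun H => rsmul H k)
  | add F G => derTerms F ∪ derTerms G
  | mul F G => (derTerms F).image (fun H => mul H G) ∪ derTerms G
  | star F => (derTerms F).image (fun H => mul H (star F))

/-- The derived terms of an expression, as a type. -/
abbrev Der (E : Expr K M) : Type (max u v) := {H : Expr K M // H ∈ derTerms E}

/-- The renaming `H ↦ H k` of the derived terms of `F` into those of `F k`. -/
def derRsmul (F : Expr K M) (k : K) (H : Der F) : Der (rsmul F k) :=
  ⟨rsmul H.1 k, by classical exact Finset.mem_image_of_mem _ H.2⟩

/-- The renaming `H ↦ H · F*` of the derived terms of `F` into those of `F*`. -/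
def derStar (F : Expr K M) (H : Der F) : Der (star F) :=
  ⟨mul H.1 (star F), by classical exact Finset.mem_image_of_mem _ H.2⟩

/-- The natural map from the disjoint union of the derived terms of `F` and `G` onto the derived
terms of `F + G`: it merges two terms if they are equal. -/
def derAdd (F G : Expr K M) : Der F ⊕ Der G → Der (add F G) :=
  Sum.elim (fun H => ⟨H.1, by classical exact Finset.mem_union_left _ H.2⟩)
    (fun H => ⟨H.1, by classical exact Finset.mem_union_right _ H.2⟩)

/-- The natural map from the disjoint union of the derived terms of `F`, multiplied by `G`, and of
the derived terms of `G` onto the derived terms of `F · G`: it merges two terms if they are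
equal. -/
def derMul (F G : Expr K M) : Der F ⊕ Der G → Der (mul F G) :=
  Sum.elim
    (fun H => ⟨mul H.1 G, by
      classical exact Finset.mem_union_left _ (Finset.mem_image_of_mem _ H.2)⟩)
    (fun H => ⟨H.1, by classical exact Finset.mem_union_right _ H.2⟩)

theorem derRsmul_surjective (F : Expr K M) (k : K) : Function.Surjective (derRsmul F k) := by
  classical
  rintro ⟨H, hH⟩
  obtain ⟨L, hL, rfl⟩ := Finset.mem_image.1 hH
  exact ⟨⟨L, hL⟩, rfl⟩

theorem derStar_surjective (F : Expr K M) : Function.Surjective (derStar F) := by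
  classical
  rintro ⟨H, hH⟩
  obtain ⟨L, hL, rfl⟩ := Finset.mem_image.1 hH
  exact ⟨⟨L, hL⟩, rfl⟩

theorem derAdd_surjective (F G : Expr K M) : Function.Surjective (derAdd F G) := by
  classical
  rintro ⟨H, hH⟩
  rcases Finset.mem_union.1 hH with h | h
  · exact ⟨Sum.inl ⟨H, h⟩, rfl⟩
  · exact ⟨Sum.inr ⟨H, h⟩, rfl⟩

theorem derMul_surjective (F G : Expr K M) : Function.Surjective (derMul F G) := by
  classical
  rintro ⟨H, hH⟩
  rcases Finset.mem_union.1 hH with h | h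
  · obtain ⟨L, hL, rfl⟩ := Finset.mem_image.1 h
    exact ⟨Sum.inl ⟨L, hL⟩, rfl⟩
  · exact ⟨Sum.inr ⟨H, h⟩, rfl⟩

open Classical in
/-- The states of the derived-term automaton: `E` itself and the derived terms of `E`. -/
abbrev DState (E : Expr K M) : Type (max u v) := {H : Expr K M // H ∈ insert E (derTerms E)}

/-- The natural map from the states of the standard derived-term automaton, the initial state
being indexed by `E`, to the set of expressions they are indexed by.  If `E` is a derived term of
`E`, it merges the initial state with the state `E`; otherwise it is a bijection. -/
def omega (E : Expr K M) : Unit ⊕ Der E → DState E :=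
  Sum.elim (fun _ => ⟨E, by classical exact Finset.mem_insert_self _ _⟩)
    (fun H => ⟨H.1, by classical exact Finset.mem_insert_of_mem H.2⟩)

theorem omega_surjective (E : Expr K M) : Function.Surjective (omega E) := by
  classical
  rintro ⟨H, hH⟩
  rcases Finset.mem_insert.1 hH with rfl | h
  · exact ⟨Sum.inl (), rfl⟩
  · exact ⟨Sum.inr ⟨H, h⟩, rfl⟩

end

section

variable {K : Type u} {M : Type v} [Semiring K] [TopologicalSpace K] [Monoid M]

/-! ### The standard derived-term automaton and the derived-term automaton -/

/-- The standard derived-term automaton of an expression, in block form. -/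
def term : (E : Expr K M) → StdAut K M (Der E)
  | zero => (StdAut.const 0).image Empty.elim (fun H => by simpa [derTerms] using H.2)
  | one => (StdAut.const 1).image Empty.elim (fun H => by simpa [derTerms] using H.2)
  | atom m hm => StdAut.single _ m hm
  | lsmul k F => (term F).lsmul k
  | rsmul F k => ((term F).rsmul k).image (derRsmul F k) (derRsmul_surjective F k)
  | add F G => ((term F).add (term G)).image (derAdd F G) (derAdd_surjective F G)
  | mul F G => ((term F).mul (term G)).image (derMul F G) (derMul_surjective F G)
  | star F => (term F).star.image (derStar F) (derStar_surjective F)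

/-- The standard derived-term automaton of an expression; its states are the initial state and the
derived terms. -/
def termAutomaton (E : Expr K M) : Automaton K M (Unit ⊕ Der E) :=
  (term E).toAutomaton

/-- The derived-term automaton of an expression: the image of the standard derived-term automaton
by `omega` (which is this automaton itself, with its initial state named `E`, if `E` is not a
derived term of `E`). -/
def derivedTermAutomaton (E : Expr K M) : Automaton K M (DState E) :=
  (termAutomaton E).image (omega E) (omega_surjective E)

end

end Expr

end WExpr

end

/-!
Label the positions of `E` by derived terms, following the recursive definition of `D(E)`. The
formal linear combination of the labels, weighted by the transitions leaving a state, then depends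
only on the label `H` of that state: it is the derivative of `H`. Hence merging states with equal
labels is a morphism, from the position automaton as well as from `T_E`, onto `D_E`.

For a valid `H`, the series satisfies `|H| = c(H) + |deriv H|`. The only delicate case is a star:
if `c` is starrable and `L` is proper, each coefficient of `(c + L) ^ n` obeys a linear recurrence
in `n` whose inhomogeneous term only involves shorter elements of `M`, so that `c + L` is starrable,
and `(c + L)* = c* (1 + L (c + L)*)`. Applied to the labels of `D_E`, these identities form a linear
system `x = T + E x`, whose only solution is `E* T` since `E` is proper.
-/

noncomputable section

namespace WExpr

section Summability

open Filter Finset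

theorem hasSum_mul_of_summable {R ι κ : Type*} [NonUnitalNonAssocSemiring R] [TopologicalSpace R]
    [ContinuousMul R] [T2Space R] {x : ι → R} {y : κ → R} {a b : R}
    (hx : HasSum x a) (hy : HasSum y b) (hxy : Summable fun p : ι × κ => x p.1 * y p.2) :
    HasSum (fun p : ι × κ => x p.1 * y p.2) (a * b) := by
  classical
  have hsum := hxy.hasSum
  simp only [HasSum, SummationFilter.unconditional_filter] at hx hy hsum
  have hprod : Tendsto (fun s : Finset ι × Finset κ => ∑ p ∈ s.1 ×ˢ s.2, x p.1 * y p.2) atTop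
      (nhds (a * b)) := by
    simp only [sum_product, ← sum_mul_sum, ← prod_atTop_atTop_eq]
    exact (hx.comp tendsto_fst).mul (hy.comp tendsto_snd)
  rw [tendsto_nhds_unique hprod (hsum.comp tendsto_finsetProd_atTop)]
  exact hxy.hasSum

theorem hasSum_sum_antidiagonal {A R : Type*} [AddMonoid A] [HasAntidiagonal A] [AddCommMonoid R]
    [TopologicalSpace R] {f : A × A → R} {a : R} (hf : HasSum f a) :
    HasSum (fun n => ∑ p ∈ antidiagonal n, f p) a := by
  classical
  refine hf.hasSum_of_sum_eq fun u =>
    ⟨u.image fun p => p.1 + p.2, fun v hv => ⟨v.biUnion antidiagonal, fun p hp => ?_, ?_⟩⟩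
  · exact mem_biUnion.2 ⟨_, hv (mem_image_of_mem _ hp), mem_antidiagonal.2 rfl⟩
  · refine sum_biUnion fun m _ n _ hmn => disjoint_left.2 fun p hm hn => hmn ?_
    rw [← mem_antidiagonal.1 hm, mem_antidiagonal.1 hn]

variable {K : Type*} [Semiring K] [TopologicalSpace K] [IsStrongSemiring K] {c β : K} {a b : ℕ → K}

/- The solution of the recurrence is the convolution of the powers of `c` with `a 0, b 0, b 1, …` -/
theorem hasSum_of_linear_recurrence (hc : Starrable c) (hb : HasSum b β)
    (ha : ∀ n, a (n + 1) = c * a n + b n) : HasSum a (kstar c * (a 0 + β)) := by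
  let d : ℕ → K := fun n => Nat.casesOn n (a 0) b
  have hd : HasSum d (a 0 + β) := HasSum.zero_add (f := d) hb
  have hcd : HasSum (fun p : ℕ × ℕ => c ^ p.1 * d p.2) (kstar c * (a 0 + β)) :=
    hasSum_mul_of_summable hc.hasSum hd (IsStrongSemiring.summable_mul _ _ hc hd.summable)
  have had (n : ℕ) : a n = ∑ p ∈ antidiagonal n, c ^ p.1 * d p.2 := by
    induction n with
    | zero => simp [d]
    | succ n ih =>
      rw [ha, ih, Nat.sum_antidiagonal_succ, mul_sum, add_comm]
      simp [d, pow_succ', mul_assoc]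
  simpa only [← had] using hasSum_sum_antidiagonal hcd

end Summability

namespace IsGradedMonoid

variable {M : Type*} [Monoid M] [IsGradedMonoid M]

/-- A chosen additive length on a graded monoid, positive on the elements different from `1`. -/
def len (m : M) : ℕ := (exists_length (M := M)).choose m

theorem len_mul (a b : M) : len (a * b) = len a + len b :=
  (exists_length (M := M)).choose_spec.1 a b

theorem len_one : len (1 : M) = 0 := by
  simpa using len_mul (1 : M) 1

theorem len_eq_zero {a : M} : len a = 0 ↔ a = 1 :=
  ⟨fun h => by_contra fun ha => ((exists_length (M := M)).choose_spec.2 a ha).ne' h,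
    fun h => h ▸ len_one⟩

/-- The finite set of pairs `(a, b)` with `a * b = m`, over which the coefficient of `m` in a Cauchy
product is summed. -/
def factorisations (m : M) : Finset (M × M) := (finite_factorisations m).toFinset

@[simp]
theorem mem_factorisations {m : M} {p : M × M} : p ∈ factorisations m ↔ p.1 * p.2 = m := by
  simp [factorisations]

theorem sum_factorisations_eq_one_left {A : Type*} [AddCommMonoid A] {m : M} {f : M × M → A}
    (hf : ∀ p, p.1 ≠ 1 → f p = 0) : ∑ p ∈ factorisations m, f p = f (1, m) := by
  refine Finset.sum_eq_single (1, m) (fun p hp hpm => hf p fun h => hpm ?_) (by simp)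
  ext <;> simp_all

theorem sum_factorisations_eq_one_right {A : Type*} [AddCommMonoid A] {m : M} {f : M × M → A}
    (hf : ∀ p, p.2 ≠ 1 → f p = 0) : ∑ p ∈ factorisations m, f p = f (m, 1) := by
  refine Finset.sum_eq_single (m, 1) (fun p hp hpm => hf p fun h => hpm ?_) (by simp)
  ext <;> simp_all

end IsGradedMonoid

open IsGradedMonoid

/-- The semiring of series: a copy of `Series K M`, whose product is the Cauchy product instead of
the pointwise product that `M → K` carries. -/
def CauchySeries (K M : Type*) : Type _ := Series K M

namespace CauchySeries

variable {K M : Type*} [Semiring K]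

instance : AddCommMonoid (CauchySeries K M) := inferInstanceAs (AddCommMonoid (M → K))

instance [TopologicalSpace K] : TopologicalSpace (CauchySeries K M) :=
  inferInstanceAs (TopologicalSpace (M → K))

/-- A series, seen in the semiring of series. -/
def of : Series K M ≃+ CauchySeries K M := AddEquiv.refl _

/-- The coefficient of `m` in a series. -/
def coeff (m : M) : CauchySeries K M →+ K := Pi.evalAddMonoidHom (fun _ => K) m

@[simp]
theorem coeff_of (m : M) (s : Series K M) : coeff m (of s) = s m := rfl

@[ext]
theorem ext {s t : CauchySeries K M} (h : ∀ m, coeff m s = coeff m t) : s = t := funext h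

theorem hasSum_iff_coeff [TopologicalSpace K] {ι : Type*} {f : ι → CauchySeries K M}
    {s : CauchySeries K M} :
    HasSum f s ↔ ∀ m, HasSum (fun i => coeff m (f i)) (coeff m s) := Pi.hasSum

theorem summable_iff_coeff [TopologicalSpace K] {ι : Type*} {f : ι → CauchySeries K M} :
    Summable f ↔ ∀ m, Summable fun i => coeff m (f i) := Pi.summable

variable [Monoid M]

instance : One (CauchySeries K M) := ⟨of (Series.mono 1)⟩

open Classical in
theorem coeff_one (m : M) : coeff m (1 : CauchySeries K M) = if m = 1 then 1 else 0 := rfl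

variable [IsGradedMonoid M]

instance : Mul (CauchySeries K M) := ⟨fun s t => of (Series.cauchy (of.symm s) (of.symm t))⟩

theorem coeff_mul (m : M) (s t : CauchySeries K M) :
    coeff m (s * t) = ∑ p ∈ factorisations m, coeff p.1 s * coeff p.2 t := rfl

protected theorem mul_assoc (s t u : CauchySeries K M) : s * t * u = s * (t * u) := by
  ext m
  simp only [coeff_mul, Finset.sum_mul, Finset.mul_sum, Finset.sum_sigma']
  refine Finset.sum_nbij' (fun x => ⟨(x.2.1, x.2.2 * x.1.2), (x.2.2, x.1.2)⟩)
    (fun x => ⟨(x.1.1 * x.2.1, x.2.2), (x.1.1, x.2.1)⟩) ?_ ?_ ?_ ?_ ?_ <;>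
    rintro ⟨⟨a, b⟩, ⟨a', b'⟩⟩ h <;>
    simp only [Finset.mem_sigma, mem_factorisations] at h ⊢ <;>
    simp [← h.1, ← h.2, mul_assoc]

instance : Semiring (CauchySeries K M) where
  left_distrib s t u := by ext; simp [coeff_mul, mul_add, Finset.sum_add_distrib]
  right_distrib s t u := by ext; simp [coeff_mul, add_mul, Finset.sum_add_distrib]
  zero_mul s := by ext; simp [coeff_mul]
  mul_zero s := by ext; simp [coeff_mul]
  mul_assoc := CauchySeries.mul_assoc
  one_mul s := by
    ext m
    rw [coeff_mul, sum_factorisations_eq_one_left fun p hp => by simp [coeff_one, hp]]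
    simp [coeff_one]
  mul_one s := by
    ext m
    rw [coeff_mul, sum_factorisations_eq_one_right fun p hp => by simp [coeff_one, hp]]
    simp [coeff_one]

/-- Polynomials, i.e. finite linear combinations of elements of `M`, seen as series. -/
def ofPoly : MonoidAlgebra K M →+* CauchySeries K M where
  toFun a := of a.coeff
  map_zero' := by ext; simp
  map_one' := by
    classical
    ext; simp [coeff_one, MonoidAlgebra.one_def, Finsupp.single_apply, eq_comm]
  map_add' a b := by ext; simp
  map_mul' a b := by
    ext m
    exact MonoidAlgebra.coeff_mul_antidiag a b m _ mem_factorisations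

@[simp]
theorem coeff_ofPoly (m : M) (a : MonoidAlgebra K M) : coeff m (ofPoly a) = a.coeff m := rfl

theorem ofPoly_single_one (m : M) :
    ofPoly (MonoidAlgebra.single m (1 : K)) = of (Series.mono m) := by
  classical
  ext; simp [Series.mono, Finsupp.single_apply, eq_comm]

/-- Scalars, seen as series supported by `1`. -/
def C : K →+* CauchySeries K M := ofPoly.comp MonoidAlgebra.singleOneRingHom

open Classical in
theorem coeff_C (m : M) (k : K) : coeff m (C k) = if m = 1 then k else 0 := by
  simp [C, Finsupp.single_apply, eq_comm]

@[simp]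
theorem coeff_C_mul (m : M) (k : K) (s : CauchySeries K M) :
    coeff m (C k * s) = k * coeff m s := by
  rw [coeff_mul, sum_factorisations_eq_one_left fun p hp => by simp [coeff_C, hp]]
  simp [coeff_C]

@[simp]
theorem coeff_mul_C (m : M) (s : CauchySeries K M) (k : K) :
    coeff m (s * C k) = coeff m s * k := by
  rw [coeff_mul, sum_factorisations_eq_one_right fun p hp => by simp [coeff_C, hp]]
  simp [coeff_C]

theorem ofPoly_smul (k : K) (a : MonoidAlgebra K M) : ofPoly (k • a) = C k * ofPoly a := by
  ext; simp

/-- The length filtration: the series whose coefficients vanish on all elements of length less than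
`n`. For `n = 1`, these are the proper series. -/
def vanishingBelow (K M : Type*) [Semiring K] [Monoid M] [IsGradedMonoid M] (n : ℕ) :
    AddSubmonoid (CauchySeries K M) where
  carrier := {s | ∀ m, len m < n → coeff m s = 0}
  zero_mem' := by simp
  add_mem' hs ht m hm := by rw [map_add, hs m hm, ht m hm, add_zero]

theorem mem_vanishingBelow {n : ℕ} {s : CauchySeries K M} :
    s ∈ vanishingBelow K M n ↔ ∀ m, len m < n → coeff m s = 0 := Iff.rfl

theorem mem_vanishingBelow_zero (s : CauchySeries K M) : s ∈ vanishingBelow K M 0 :=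
  fun m hm => absurd hm (len m).not_lt_zero

theorem mem_vanishingBelow_one {s : CauchySeries K M} :
    s ∈ vanishingBelow K M 1 ↔ coeff 1 s = 0 := by
  simp [mem_vanishingBelow, len_eq_zero]

theorem mul_mem_vanishingBelow {i j : ℕ} {s t : CauchySeries K M} (hs : s ∈ vanishingBelow K M i)
    (ht : t ∈ vanishingBelow K M j) : s * t ∈ vanishingBelow K M (i + j) := by
  refine fun m hm => Finset.sum_eq_zero fun p hp => ?_
  rw [← mem_factorisations.1 hp, len_mul] at hm
  obtain h | h : len p.1 < i ∨ len p.2 < j := by omega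
  · exact mul_eq_zero_of_left (hs p.1 h) _
  · exact mul_eq_zero_of_right _ (ht p.2 h)

theorem mul_mem_vanishingBelow_left {n : ℕ} {s : CauchySeries K M} (hs : s ∈ vanishingBelow K M n)
    (t : CauchySeries K M) : s * t ∈ vanishingBelow K M n :=
  mul_mem_vanishingBelow hs (mem_vanishingBelow_zero t)

theorem mul_mem_vanishingBelow_right {n : ℕ} (s : CauchySeries K M) {t : CauchySeries K M}
    (ht : t ∈ vanishingBelow K M n) : s * t ∈ vanishingBelow K M n :=
  zero_add n ▸ mul_mem_vanishingBelow (mem_vanishingBelow_zero s) ht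

theorem of_pow (s : Series K M) (n : ℕ) : of (Series.pow s n) = of s ^ n := by
  induction n with
  | zero => exact (pow_zero _).symm
  | succ n ih => rw [pow_succ, ← ih]; rfl

theorem coeff_C_add_pow_succ (c : K) (L : CauchySeries K M) (m : M) (n : ℕ) :
    coeff m ((C c + L) ^ (n + 1)) = c * coeff m ((C c + L) ^ n) + coeff m (L * (C c + L) ^ n) := by
  rw [pow_succ', add_mul, map_add, coeff_C_mul]

section Star

variable [TopologicalSpace K]

theorem starrable_of {s : Series K M} : Starrable (of s) ↔ Series.Starrable s := by
  simp only [Starrable, ← of_pow]; rfl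

theorem of_star (s : Series K M) : of (Series.star s) = kstar (of s) := by
  simp only [kstar, ← of_pow]; rfl

variable [IsStrongSemiring K] {c : K} {L : CauchySeries K M}

/- Since `L` is proper, the coefficient of `m` in `L * s` only involves the coefficients of `s` on
elements shorter than `m`, whence an induction on the length of `m`. -/
theorem starrable_C_add (hc : Starrable c) (hL : L ∈ vanishingBelow K M 1) :
    Starrable (C c + L) := by
  refine summable_iff_coeff.2 fun m => ?_
  induction hm : len m using Nat.strong_induction_on generalizing m with
  | _ l ih =>
    have hLpow : Summable fun n => coeff m (L * (C c + L) ^ n) := by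
      simp only [coeff_mul]
      refine summable_sum fun p hp => ?_
      rw [← mem_factorisations.1 hp, len_mul] at hm
      by_cases h : len p.1 = 0
      · simp [hL p.1 (by omega)]
      · exact (ih (len p.2) (by omega) p.2 rfl).mul_left _
    exact (hasSum_of_linear_recurrence hc hLpow.hasSum (coeff_C_add_pow_succ c L m)).summable

theorem kstar_C_add (hc : Starrable c) (hL : L ∈ vanishingBelow K M 1) :
    kstar (C c + L) = C (kstar c) * (1 + L * kstar (C c + L)) := by
  have hsum (m : M) : HasSum (fun n => coeff m ((C c + L) ^ n)) (coeff m (kstar (C c + L))) :=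
    hasSum_iff_coeff.1 (starrable_C_add hc hL).hasSum m
  ext m
  have hLsum : HasSum (fun n => coeff m (L * (C c + L) ^ n)) (coeff m (L * kstar (C c + L))) :=
    hasSum_sum fun p _ => (hsum p.2).mul_left _
  rw [coeff_C_mul, map_add, ← pow_zero (C c + L)]
  exact (hsum m).unique (hasSum_of_linear_recurrence hc hLsum (coeff_C_add_pow_succ c L m))

end Star

end CauchySeries

section FormalSum

variable {ι κ X Y A : Type*} [Fintype ι] [Fintype κ] [AddCommMonoid A]

/-- The formal linear combination `∑ q, a q · f q` of the labels `f q`, as a finitely supported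
function; labels may coincide, in which case their coefficients add up. -/
def formalSum (f : ι → X) (a : ι → A) : X →₀ A := ∑ q, Finsupp.single (f q) (a q)

theorem formalSum_zero (f : ι → X) : formalSum f (fun _ => (0 : A)) = 0 := by
  simp [formalSum]

theorem formalSum_add (f : ι → X) (a b : ι → A) :
    formalSum f (fun q => a q + b q) = formalSum f a + formalSum f b := by
  simp [formalSum, Finset.sum_add_distrib]

theorem formalSum_smul {S : Type*} [Semiring S] [Module S A] (f : ι → X) (k : S) (a : ι → A) :
    formalSum f (fun q => k • a q) = k • formalSum f a := by
  simp [formalSum, Finset.smul_sum]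

theorem formalSum_comp (φ : X → Y) (f : ι → X) (a : ι → A) :
    formalSum (fun q => φ (f q)) a = Finsupp.mapDomain φ (formalSum f a) := by
  simp [formalSum, Finsupp.mapDomain_finsetSum, Finsupp.mapDomain_single]

theorem formalSum_sumElim (f : ι → X) (g : κ → X) (a : ι ⊕ κ → A) :
    formalSum (Sum.elim f g) a = formalSum f (a ∘ Sum.inl) + formalSum g (a ∘ Sum.inr) := by
  simp [formalSum]

open Classical in
theorem formalSum_fiberwise (φ : ι → κ) (g : κ → X) (a : ι → A) :
    formalSum g (fun r => ∑ q with φ q = r, a q) = formalSum (g ∘ φ) a := by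
  rw [formalSum, formalSum, ← Finset.sum_fiberwise (g := φ)]
  refine Finset.sum_congr rfl fun r _ => ?_
  rw [Finsupp.single_finsetSum]
  refine Finset.sum_congr rfl fun q hq => ?_
  rw [Function.comp_apply, (Finset.mem_filter.1 hq).2]

theorem formalSum_injective {f : ι → X} (hf : Function.Injective f) :
    Function.Injective (formalSum f : (ι → A) → X →₀ A) := by
  classical
  have hval (a : ι → A) (q : ι) : formalSum f a (f q) = a q := by
    simp [formalSum, Finsupp.single_apply, hf.eq_iff]
  exact fun a b h => funext fun q => by rw [← hval a, ← hval b, h]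

theorem liftAddHom_formalSum {B : Type*} [AddCommMonoid B] (v : X → A →+ B) (f : ι → X)
    (a : ι → A) : Finsupp.liftAddHom v (formalSum f a) = ∑ q, v (f q) (a q) := by
  simp [formalSum]

end FormalSum

open Classical in
theorem Automaton.isMorphism_iff {K M Q R : Type*} [Semiring K] [Monoid M] [Fintype Q] [Fintype R]
    {A : Automaton K M Q} {B : Automaton K M R} {φ : Q → R} :
    A.IsMorphism B φ ↔ Function.Surjective φ ∧ (∀ r, ∑ q with φ q = r, A.init q = B.init r) ∧
      (∀ p r, ∑ q with φ q = r, A.trans p q = B.trans (φ p) r) ∧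
      ∀ p, A.final p = B.final (φ p) := by
  simp only [IsMorphism, ConjugateBy, amalgamation, funext_iff, ← Matrix.ext_iff, Matrix.vecMul,
    Matrix.mulVec, dotProduct, Matrix.mul_apply, Matrix.map_apply, Matrix.of_apply,
    apply_ite (MonoidAlgebra.singleOneRingHom : K →+* MonoidAlgebra K M), map_one, map_zero,
    mul_ite, ite_mul, mul_one, mul_zero, one_mul, zero_mul, Finset.sum_ite_eq, Finset.mem_univ,
    if_true, Finset.sum_filter]

section Represents

variable {K M : Type*} [Semiring K] [TopologicalSpace K] [Monoid M]

open Finsupp in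
/-- The total derivative of an expression: the formal linear combination of its derived terms whose
polynomial coefficients are the labels of the transitions that leave the expression. -/
def Expr.deriv : Expr K M → (Expr K M →₀ MonoidAlgebra K M)
  | .zero => 0
  | .one => 0
  | .atom m _ => single .one (MonoidAlgebra.single m 1)
  | .lsmul k F => k • deriv F
  | .rsmul F k => mapDomain (fun H => .rsmul H k) (deriv F)
  | .add F G => deriv F + deriv G
  | .mul F G => mapDomain (fun H => .mul H G) (deriv F) + constTerm F • deriv G
  | .star F => kstar (constTerm F) • mapDomain (fun H => .mul H (.star F)) (deriv F)

/-- The automaton `A`, its states being labelled by expressions by means of `f`, represents `E`: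
its initial weights add up to the single label `E`, and the transitions and the final weight of
every state are given by the derivative and the constant term of its label. -/
structure Automaton.Represents {Q : Type*} [Fintype Q] (A : Automaton K M Q) (E : Expr K M)
    (f : Q → Expr K M) : Prop where
  init : formalSum f A.init = Finsupp.single E 1
  trans : ∀ p, formalSum f (A.trans p) = (f p).deriv
  final : ∀ p, A.final p = (f p).constTerm

/-- `Automaton.Represents` in the block form of a standard automaton, whose initial state is
labelled by `E`. -/
structure StdAut.Represents {ι : Type*} [Fintype ι] (A : StdAut K M ι) (E : Expr K M)
    (f : ι → Expr K M) : Prop where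
  c : A.c = E.constTerm
  J : formalSum f A.J = E.deriv
  F : ∀ p, formalSum f (A.F p) = (f p).deriv
  U : ∀ p, A.U p = (f p).constTerm

namespace StdAut.Represents

variable {ι κ : Type*} [Fintype ι] [Fintype κ] {A : StdAut K M ι} {B : StdAut K M κ}
  {E G : Expr K M} {f : ι → Expr K M} {g : κ → Expr K M}

theorem const_zero (f : Empty → Expr K M) : (const (M := M) (0 : K)).Represents .zero f :=
  ⟨rfl, by simp [formalSum, Expr.deriv], fun p => p.elim, fun p => p.elim⟩

theorem const_one (f : Empty → Expr K M) : (const (M := M) (1 : K)).Represents .one f :=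
  ⟨rfl, by simp [formalSum, Expr.deriv], fun p => p.elim, fun p => p.elim⟩

theorem single [Unique ι] {m : M} (hm : m ≠ 1) (hf : ∀ p, f p = .one) :
    (StdAut.single ι m hm).Represents (.atom m hm) f where
  c := rfl
  J := by simp [formalSum, StdAut.single, Expr.deriv, hf]
  F := by simp [formalSum, StdAut.single, Expr.deriv, hf]
  U := by simp [StdAut.single, Expr.constTerm, hf]

theorem lsmul (h : A.Represents E f) (k : K) : (A.lsmul k).Represents (.lsmul k E) f where
  c := congrArg (k * ·) h.c
  J := by simp only [StdAut.lsmul, formalSum_smul, h.J, Expr.deriv]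
  F := h.F
  U := h.U

theorem rsmul (h : A.Represents E f) (k : K) :
    (A.rsmul k).Represents (.rsmul E k) (fun p => .rsmul (f p) k) where
  c := congrArg (· * k) h.c
  J := by simp only [StdAut.rsmul, formalSum_comp (Expr.rsmul · k), h.J, Expr.deriv]
  F p := by simp only [StdAut.rsmul, formalSum_comp (Expr.rsmul · k), h.F, Expr.deriv]
  U p := congrArg (· * k) (h.U p)

theorem add (hA : A.Represents E f) (hB : B.Represents G g) :
    (A.add B).Represents (.add E G) (Sum.elim f g) where
  c := congrArg₂ (· + ·) hA.c hB.c
  J := by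
    simp only [StdAut.add, formalSum_sumElim, Sum.elim_comp_inl, Sum.elim_comp_inr, hA.J, hB.J,
      Expr.deriv]
  F := by
    rintro (p | p)
    · calc formalSum (Sum.elim f g) ((A.add B).F (.inl p))
          = formalSum f (A.F p) + formalSum g (fun _ => 0) := formalSum_sumElim f g _
        _ = (f p).deriv := by rw [formalSum_zero, add_zero, hA.F]
    · calc formalSum (Sum.elim f g) ((A.add B).F (.inr p))
          = formalSum f (fun _ => 0) + formalSum g (B.F p) := formalSum_sumElim f g _
        _ = (g p).deriv := by rw [formalSum_zero, zero_add, hB.F]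
  U := by rintro (p | p); exacts [hA.U p, hB.U p]

theorem mul (hA : A.Represents E f) (hB : B.Represents G g) :
    (A.mul B).Represents (.mul E G) (Sum.elim (fun p => .mul (f p) G) g) where
  c := congrArg₂ (· * ·) hA.c hB.c
  J := by
    simp only [StdAut.mul, formalSum_sumElim, Sum.elim_comp_inl, Sum.elim_comp_inr,
      formalSum_comp (Expr.mul · G), formalSum_smul, hA.J, hB.J, hA.c, Expr.deriv]
  F := by
    rintro (p | p)
    · calc formalSum (Sum.elim (fun p => (f p).mul G) g) ((A.mul B).F (.inl p))
          = formalSum (fun p => (f p).mul G) (A.F p) + formalSum g (fun q => A.U p • B.J q) :=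
            formalSum_sumElim _ g _
        _ = ((f p).mul G).deriv := by
            rw [formalSum_comp (Expr.mul · G), formalSum_smul, hA.F, hA.U, hB.J, Expr.deriv]
    · calc formalSum (Sum.elim (fun p => (f p).mul G) g) ((A.mul B).F (.inr p))
          = formalSum (fun p => (f p).mul G) (fun _ => 0) + formalSum g (B.F p) :=
            formalSum_sumElim _ g _
        _ = (g p).deriv := by rw [formalSum_zero, zero_add, hB.F]
  U := by
    rintro (p | p)
    exacts [congrArg₂ (· * ·) (hA.U p) hB.c, hB.U p]

theorem star (h : A.Represents E f) :
    A.star.Represents (.star E) (fun p => .mul (f p) (.star E)) where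
  c := congrArg kstar h.c
  J := by
    simp only [StdAut.star, formalSum_comp (Expr.mul · E.star), formalSum_smul,
      Finsupp.mapDomain_smul, h.J, h.c, Expr.deriv]
  F p :=
    calc formalSum (fun p => (f p).mul E.star) (A.star.F p)
        = formalSum (fun p => (f p).mul E.star) (fun q => (A.U p * kstar A.c) • A.J q) +
            formalSum (fun p => (f p).mul E.star) (A.F p) := formalSum_add _ _ _
      _ = ((f p).mul E.star).deriv := by
          simp only [formalSum_comp (Expr.mul · E.star), formalSum_smul, Finsupp.mapDomain_smul,
            h.J, h.F, h.c, h.U, mul_smul, Expr.deriv]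
          exact add_comm _ _
  U p := congrArg₂ (· * kstar ·) (h.U p) h.c

theorem image {φ : ι → κ} (hφ : Function.Surjective φ) (h : A.Represents E (g ∘ φ)) :
    (A.image φ hφ).Represents E g := by
  have hs (r : κ) : g r = (g ∘ φ) (Function.surjInv hφ r) :=
    congrArg g (Function.surjInv_eq hφ r).symm
  refine ⟨h.c, (formalSum_fiberwise φ g A.J).trans h.J, fun r => ?_, fun r => ?_⟩
  · rw [hs, ← h.F]
    exact formalSum_fiberwise φ g (A.F _)
  · rw [hs, ← h.U]
    rfl

theorem toAutomaton (h : A.Represents E f) :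
    A.toAutomaton.Represents E (Sum.elim (fun _ => E) f) where
  init := by simp [formalSum, StdAut.toAutomaton]
  trans := by
    rintro (⟨⟩ | p)
    · calc formalSum (Sum.elim (fun _ => E) f) (A.toAutomaton.trans (.inl ()))
          = formalSum (fun _ => E) (fun _ => 0) + formalSum f A.J := formalSum_sumElim _ f _
        _ = E.deriv := by rw [formalSum_zero, zero_add, h.J]
    · calc formalSum (Sum.elim (fun _ => E) f) (A.toAutomaton.trans (.inr p))
          = formalSum (fun _ => E) (fun _ => 0) + formalSum f (A.F p) := formalSum_sumElim _ f _
        _ = (f p).deriv := by rw [formalSum_zero, zero_add, h.F]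
  final := by rintro (⟨⟩ | p); exacts [h.c, h.U p]

end StdAut.Represents

namespace Automaton.Represents

variable {Q R : Type*} [Fintype Q] [Fintype R] {A : Automaton K M Q} {B : Automaton K M R}
  {E : Expr K M} {φ : Q → R} {f : Q → Expr K M} {g : R → Expr K M}

theorem sum_init_mul (hA : A.Represents E f) (v : Expr K M → K) :
    ∑ p, A.init p * v (f p) = v E := by
  have h := liftAddHom_formalSum (fun H => AddMonoidHom.mulRight (v H)) f A.init
  rw [hA.init] at h
  simpa using h.symm

theorem image (hφ : Function.Surjective φ) (h : A.Represents E (g ∘ φ)) :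
    (A.image φ hφ).Represents E g := by
  have hs (r : R) : g r = (g ∘ φ) (Function.surjInv hφ r) :=
    congrArg g (Function.surjInv_eq hφ r).symm
  refine ⟨(formalSum_fiberwise φ g A.init).trans h.init, fun r => ?_, fun r => ?_⟩
  · rw [hs, ← h.trans]
    exact formalSum_fiberwise φ g (A.trans _)
  · rw [hs, ← h.final]
    rfl

/- As distinct states of `B` have distinct labels, the weights of `B` can be read off the formal
sums, which `φ` preserves. -/
theorem isMorphism (hA : A.Represents E (g ∘ φ)) (hB : B.Represents E g)
    (hg : Function.Injective g) (hφ : Function.Surjective φ) : A.IsMorphism B φ := by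
  classical
  refine isMorphism_iff.2 ⟨hφ, congrFun (formalSum_injective hg ?_),
    fun p => congrFun (formalSum_injective hg ?_), fun p => ?_⟩
  · rw [hB.init, ← hA.init]
    convert formalSum_fiberwise φ g A.init
  · rw [hB.trans, ← Function.comp_apply (f := g), ← hA.trans]
    convert formalSum_fiberwise φ g (A.trans p)
  · rw [hA.final, hB.final, Function.comp_apply]

end Automaton.Represents

end Represents

namespace Expr

section DerivedTerms

variable {K M : Type*} [Monoid M]

/-- The derived term that labels a position. -/
def posTerm : (E : Expr K M) → Pos E → Expr K M
  | zero => Empty.elim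
  | one => Empty.elim
  | atom _ _ => fun _ => one
  | lsmul _ F => posTerm F
  | rsmul F k => fun p => rsmul (posTerm F p) k
  | add F G => Sum.elim (posTerm F) (posTerm G)
  | mul F G => Sum.elim (fun p => mul (posTerm F p) G) (posTerm G)
  | star F => fun p => mul (posTerm F p) (star F)

theorem mem_derTerms_iff_exists_posTerm (E H : Expr K M) :
    H ∈ derTerms E ↔ ∃ p, posTerm E p = H := by
  induction E generalizing H with
  | zero => simp [derTerms, Pos]
  | one => simp [derTerms, Pos]
  | atom m hm => simpa [derTerms, posTerm, Pos] using eq_comm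
  | lsmul _ _ ih => exact ih H
  | rsmul F k ih => simp [derTerms, posTerm, Pos, ih]
  | add F G ihF ihG => simp [derTerms, posTerm, Pos, ihF, ihG]
  | mul F G ihF ihG => simp [derTerms, posTerm, Pos, ihF, ihG]
  | star F ih => simp [derTerms, posTerm, Pos, ih]

/-- The map from the states of the position automaton onto those of the derived-term automaton
which sends every position to its label. -/
def posMap (E : Expr K M) : Unit ⊕ Pos E → DState E :=
  omega E ∘ Sum.map id fun p => ⟨posTerm E p, (mem_derTerms_iff_exists_posTerm E _).2 ⟨p, rfl⟩⟩

theorem posMap_surjective (E : Expr K M) : Function.Surjective (posMap E) := by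
  refine (omega_surjective E).comp (Sum.map_surjective.2 ⟨Function.surjective_id, ?_⟩)
  rintro ⟨H, hH⟩
  obtain ⟨p, rfl⟩ := (mem_derTerms_iff_exists_posTerm E H).1 hH
  exact ⟨p, rfl⟩

theorem val_comp_posMap (E : Expr K M) :
    Subtype.val ∘ posMap E = Sum.elim (fun _ => E) (posTerm E) := by
  ext1 (p | p) <;> rfl

theorem val_comp_omega (E : Expr K M) :
    Subtype.val ∘ omega E = Sum.elim (fun _ => E) Subtype.val := by
  ext1 (p | p) <;> rfl

theorem omega_eq_iff (E : Expr K M) {p q : Unit ⊕ Der E} (hpq : p ≠ q) :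
    E.omega p = E.omega q ↔
      (p = Sum.inl () ∧ ∃ h, q = Sum.inr ⟨E, h⟩) ∨
      (q = Sum.inl () ∧ ∃ h, p = Sum.inr ⟨E, h⟩) := by
  rcases p with ⟨⟩ | ⟨H, hH⟩ <;> rcases q with ⟨⟩ | ⟨L, hL⟩
  · exact absurd rfl hpq
  · suffices E = L ↔ E ∈ derTerms E ∧ L = E by simpa [omega]
    exact ⟨fun h => ⟨h ▸ hL, h.symm⟩, fun h => h.2.symm⟩
  · suffices H = E ↔ E ∈ derTerms E ∧ H = E by simpa [omega]
    exact ⟨fun h => ⟨h ▸ hH, h⟩, And.right⟩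
  · simpa [omega] using hpq

theorem omega_bijective {E : Expr K M} (hE : E ∉ derTerms E) : Function.Bijective (omega E) := by
  refine ⟨fun p q hpq => by_contra fun hne => ?_, omega_surjective E⟩
  obtain ⟨-, h, -⟩ | ⟨-, h, -⟩ := (omega_eq_iff E hne).1 hpq <;> exact hE h

end DerivedTerms

section Representations

variable {K M : Type*} [Semiring K] [TopologicalSpace K] [Monoid M]

theorem standard_represents (E : Expr K M) : (standard E).Represents E (posTerm E) := by
  induction E with
  | zero => exact .const_zero _
  | one => exact .const_one _
  | atom m hm => exact StdAut.Represents.single (ι := Unit) hm fun _ => rfl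
  | lsmul k F ih => exact ih.lsmul k
  | rsmul F k ih => exact ih.rsmul k
  | add F G ihF ihG => exact ihF.add ihG
  | mul F G ihF ihG => exact ihF.mul ihG
  | star F ih => exact ih.star

theorem term_represents (E : Expr K M) : (term E).Represents E (Subtype.val : Der E → _) := by
  induction E with
  | zero => exact (StdAut.Represents.const_zero _).image _
  | one => exact (StdAut.Represents.const_one _).image _
  | atom m hm =>
    have hone (p : Der (atom m hm : Expr K M)) : p.1 = one := by simpa [derTerms] using p.2
    let _ : Unique (Der (atom m hm : Expr K M)) :=
      ⟨⟨⟨one, by simp [derTerms]⟩⟩, fun p => Subtype.ext (hone p)⟩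
    exact .single hm hone
  | lsmul k F ih => exact ih.lsmul k
  | rsmul F k ih => exact (ih.rsmul k).image (derRsmul_surjective F k)
  | add F G ihF ihG =>
    refine .image (derAdd_surjective F G) ?_
    convert ihF.add ihG using 1
    ext1 (p | p) <;> rfl
  | mul F G ihF ihG =>
    refine .image (derMul_surjective F G) ?_
    convert ihF.mul ihG using 1
    ext1 (p | p) <;> rfl
  | star F ih => exact ih.star.image (derStar_surjective F)

theorem positionAutomaton_represents (E : Expr K M) :
    (positionAutomaton E).Represents E (Subtype.val ∘ posMap E) :=
  val_comp_posMap E ▸ (standard_represents E).toAutomaton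

theorem termAutomaton_represents (E : Expr K M) :
    (termAutomaton E).Represents E (Subtype.val ∘ omega E) :=
  val_comp_omega E ▸ (term_represents E).toAutomaton

theorem derivedTermAutomaton_represents (E : Expr K M) :
    (derivedTermAutomaton E).Represents E Subtype.val :=
  (termAutomaton_represents E).image (omega_surjective E)

theorem omega_isMorphism (E : Expr K M) :
    (termAutomaton E).IsMorphism (derivedTermAutomaton E) (omega E) :=
  (termAutomaton_represents E).isMorphism (derivedTermAutomaton_represents E)
    Subtype.val_injective (omega_surjective E)

theorem derivedTermAutomaton_isQuotient (E : Expr K M) :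
    (derivedTermAutomaton E).IsQuotient (positionAutomaton E) :=
  ⟨posMap E, (positionAutomaton_represents E).isMorphism (derivedTermAutomaton_represents E)
    Subtype.val_injective (posMap_surjective E)⟩

theorem Valid.of_mem_derTerms {E H : Expr K M} (hE : E.Valid) (hH : H ∈ derTerms E) : H.Valid := by
  classical
  induction E generalizing H with
  | zero => simp [derTerms] at hH
  | one => simp [derTerms] at hH
  | atom m hm =>
    obtain rfl : H = one := by simpa [derTerms] using hH
    trivial
  | lsmul k F ih => exact ih hE hH
  | rsmul F k ih =>
    obtain ⟨L, hL, rfl⟩ := Finset.mem_image.1 hH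
    exact (ih hE hL : L.Valid)
  | add F G ihF ihG => exact (Finset.mem_union.1 hH).elim (ihF hE.1) (ihG hE.2)
  | mul F G ihF ihG =>
    obtain hH | hH := Finset.mem_union.1 hH
    · obtain ⟨L, hL, rfl⟩ := Finset.mem_image.1 hH
      exact ⟨ihF hE.1 hL, hE.2⟩
    · exact ihG hE.2 hH
  | star F ih =>
    obtain ⟨L, hL, rfl⟩ := Finset.mem_image.1 hH
    exact ⟨ih hE.1 hL, hE⟩

end Representations

end Expr

section Arden

open Matrix CauchySeries

variable {K M Q : Type*} [Semiring K] [Monoid M] [IsGradedMonoid M] [Fintype Q]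

theorem eq_sum_pow_mulVec_add [DecidableEq Q] {S : Type*} [Semiring S] {P : Matrix Q Q S}
    {x T : Q → S} (hx : x = T + P *ᵥ x) (N : ℕ) :
    x = ∑ n ∈ Finset.range N, P ^ n *ᵥ T + P ^ N *ᵥ x := by
  induction N with
  | zero => simp
  | succ N ih =>
    calc x = ∑ n ∈ Finset.range N, P ^ n *ᵥ T + P ^ N *ᵥ x := ih
      _ = ∑ n ∈ Finset.range N, P ^ n *ᵥ T + P ^ N *ᵥ (T + P *ᵥ x) := by rw [← hx]
      _ = ∑ n ∈ Finset.range (N + 1), P ^ n *ᵥ T + P ^ (N + 1) *ᵥ x := by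
        rw [mulVec_add, mulVec_mulVec, ← pow_succ, Finset.sum_range_succ, add_assoc]

theorem pow_apply_mem_vanishingBelow [DecidableEq Q] {P : Matrix Q Q (CauchySeries K M)}
    (hP : ∀ p q, P p q ∈ vanishingBelow K M 1) (n : ℕ) (p q : Q) :
    (P ^ n) p q ∈ vanishingBelow K M n := by
  induction n generalizing q with
  | zero => exact mem_vanishingBelow_zero _
  | succ n ih =>
    rw [pow_succ, mul_apply]
    exact sum_mem fun r _ => mul_mem_vanishingBelow (ih r) (hP r q)

namespace Automaton

/-- The transition matrix of an automaton, as a matrix of series. -/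
def seriesTrans {Q : Type*} (A : Automaton K M Q) : Matrix Q Q (CauchySeries K M) :=
  A.trans.map ofPoly

variable (A : Automaton K M Q)

theorem coeff_seriesTrans_pow [DecidableEq Q] (n : ℕ) (p q : Q) (m : M) :
    coeff m ((A.seriesTrans ^ n) p q) = ((A.trans ^ n) p q).coeff m := by
  rw [seriesTrans, ← RingHom.mapMatrix_apply, ← map_pow]
  rfl

theorem seriesTrans_pow_apply_mem_vanishingBelow [DecidableEq Q] (n : ℕ) (p q : Q) :
    (A.seriesTrans ^ n) p q ∈ vanishingBelow K M n :=
  pow_apply_mem_vanishingBelow (fun p q => mem_vanishingBelow_one.2 (A.proper p q)) n p q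

variable [TopologicalSpace K]

open Classical in
theorem transStar_apply (p q : Q) (m : M) :
    A.transStar p q m =
      ∑ n ∈ Finset.range (len m + 1), coeff m ((A.seriesTrans ^ n) p q) := by
  simp only [transStar, of_apply, ← coeff_seriesTrans_pow]
  refine tsum_eq_sum fun n hn => A.seriesTrans_pow_apply_mem_vanishingBelow n p q m ?_
  simpa using hn

variable {A}

/- Arden's lemma: as the entries of the powers of the transition matrix vanish on short elements,
the equation `x = T + E x` has only the solution `E* T`. -/
theorem sum_transStar_mul_final {x : Q → CauchySeries K M}
    (hx : x = (fun q => C (A.final q)) + A.seriesTrans *ᵥ x) (p : Q) (m : M) :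
    ∑ q, A.transStar p q m * A.final q = coeff m (x p) := by
  classical
  have hremainder : coeff m ((A.seriesTrans ^ (len m + 1) *ᵥ x) p) = 0 := by
    refine sum_mem (S := vanishingBelow K M (len m + 1)) (fun q _ => ?_) m (Nat.lt_succ_self _)
    exact mul_mem_vanishingBelow_left (A.seriesTrans_pow_apply_mem_vanishingBelow _ p q) _
  rw [eq_sum_pow_mulVec_add hx (len m + 1), Pi.add_apply, map_add, hremainder, add_zero]
  simp only [transStar_apply, mulVec, dotProduct, Finset.sum_apply, map_sum, coeff_mul_C,
    Finset.sum_mul]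
  exact Finset.sum_comm

end Automaton

end Arden

section Semantics

open CauchySeries

variable {K M : Type*} [Semiring K] [TopologicalSpace K] [Monoid M] [IsGradedMonoid M]

namespace Expr

/-- The series denoted by an expression, as an element of the semiring of series. -/
def value (E : Expr K M) : CauchySeries K M := of (series E)

theorem value_zero : value (zero : Expr K M) = 0 := rfl

theorem value_one : value (one : Expr K M) = 1 := rfl

theorem value_atom (m : M) (hm : m ≠ 1) :
    value (atom m hm : Expr K M) = ofPoly (MonoidAlgebra.single m 1) :=
  (ofPoly_single_one m).symm

theorem value_lsmul (k : K) (E : Expr K M) : value (lsmul k E) = C k * value E := by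
  ext; simp [value, series]

theorem value_rsmul (E : Expr K M) (k : K) : value (rsmul E k) = value E * C k := by
  ext; simp [value, series]

theorem value_add (E F : Expr K M) : value (add E F) = value E + value F := rfl

theorem value_mul (E F : Expr K M) : value (mul E F) = value E * value F := rfl

theorem value_star (E : Expr K M) : value (star E) = kstar (value E) := of_star _

/-- The series `∑ a H * |H|` denoted by a formal linear combination `∑ a H · H` of expressions. -/
def eval : (Expr K M →₀ MonoidAlgebra K M) →+ CauchySeries K M :=
  Finsupp.liftAddHom fun H => (AddMonoidHom.mulRight (value H)).comp ofPoly.toAddMonoidHom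

theorem eval_single (H : Expr K M) (a : MonoidAlgebra K M) :
    eval (Finsupp.single H a) = ofPoly a * value H := by
  simp [eval]

theorem eval_formalSum {ι : Type*} [Fintype ι] (f : ι → Expr K M) (a : ι → MonoidAlgebra K M) :
    eval (formalSum f a) = ∑ q, ofPoly (a q) * value (f q) :=
  liftAddHom_formalSum _ f a

theorem eval_smul (k : K) (d : Expr K M →₀ MonoidAlgebra K M) :
    eval (k • d) = C k * eval d := by
  induction d using Finsupp.induction_linear with
  | zero => simp
  | add d e hd he => rw [smul_add, map_add, map_add, hd, he, mul_add]
  | single H a =>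
    rw [Finsupp.smul_single, eval_single, eval_single, ofPoly_smul, mul_assoc]

theorem eval_mapDomain {φ : Expr K M → Expr K M} {t : CauchySeries K M}
    (hφ : ∀ H, value (φ H) = value H * t) (d : Expr K M →₀ MonoidAlgebra K M) :
    eval (Finsupp.mapDomain φ d) = eval d * t := by
  induction d using Finsupp.induction_linear with
  | zero => simp
  | add d e hd he => rw [Finsupp.mapDomain_add, map_add, map_add, hd, he, add_mul]
  | single H a => rw [Finsupp.mapDomain_single, eval_single, eval_single, hφ, mul_assoc]

theorem eval_deriv_mem_vanishingBelow_one (E : Expr K M) :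
    eval (deriv E) ∈ vanishingBelow K M 1 := by
  induction E with
  | zero => simp [deriv]
  | one => simp [deriv]
  | atom m hm =>
    rw [deriv, eval_single]
    exact mul_mem_vanishingBelow_left (mem_vanishingBelow_one.2 (by simp [hm])) _
  | lsmul k F ih =>
    rw [deriv, eval_smul]
    exact mul_mem_vanishingBelow_right _ ih
  | rsmul F k ih =>
    rw [deriv, eval_mapDomain (value_rsmul · k)]
    exact mul_mem_vanishingBelow_left ih _
  | add F G ihF ihG =>
    rw [deriv, map_add]
    exact add_mem ihF ihG
  | mul F G ihF ihG =>
    rw [deriv, map_add, eval_mapDomain (value_mul · G), eval_smul]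
    exact add_mem (mul_mem_vanishingBelow_left ihF _) (mul_mem_vanishingBelow_right _ ihG)
  | star F ih =>
    rw [deriv, eval_smul, eval_mapDomain (value_mul · F.star)]
    exact mul_mem_vanishingBelow_right _ (mul_mem_vanishingBelow_left ih _)

theorem value_eq_C_add_eval_deriv [IsStrongSemiring K] {E : Expr K M} (hE : E.Valid) :
    value E = C (constTerm E) + eval (deriv E) := by
  induction E with
  | zero => simp [value_zero, constTerm, deriv]
  | one => simp [value_one, constTerm, deriv]
  | atom m hm => simp [value_atom, value_one, constTerm, deriv, eval_single]
  | lsmul k F ih =>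
    rw [value_lsmul, ih hE, constTerm, map_mul, deriv, eval_smul, mul_add]
  | rsmul F k ih =>
    rw [value_rsmul, ih hE, constTerm, map_mul, deriv, eval_mapDomain (value_rsmul · k), add_mul]
  | add F G ihF ihG =>
    rw [value_add, ihF hE.1, ihG hE.2, constTerm, map_add, deriv, map_add, add_add_add_comm]
  | mul F G ihF ihG =>
    calc value F * value G
        = C (constTerm F) * value G + eval (deriv F) * value G := by rw [← add_mul, ← ihF hE.1]
      _ = C (constTerm F) * (C (constTerm G) + eval (deriv G)) + eval (deriv F) * value G := by
        rw [← ihG hE.2]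
      _ = C (constTerm (mul F G)) + eval (deriv (mul F G)) := by
        rw [constTerm, map_mul, deriv, map_add, eval_mapDomain (value_mul · G), eval_smul,
          mul_add, add_assoc, add_comm (eval (deriv F) * value G)]
  | star F ih =>
    calc value (star F)
        = kstar (C (constTerm F) + eval (deriv F)) := by rw [value_star, ih hE.1]
      _ = C (kstar (constTerm F)) * (1 + eval (deriv F) * value (star F)) := by
        rw [kstar_C_add hE.2 (eval_deriv_mem_vanishingBelow_one F), value_star, ih hE.1]
      _ = C (constTerm (star F)) + eval (deriv (star F)) := by
        rw [constTerm, deriv, eval_smul, eval_mapDomain (value_mul · F.star), mul_add, mul_one]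

theorem Valid.seriesDefined [IsStrongSemiring K] {E : Expr K M} (hE : E.Valid) :
    E.SeriesDefined := by
  induction E with
  | zero | one | atom => trivial
  | lsmul _ _ ih | rsmul _ _ ih => exact ih hE
  | add F G ihF ihG | mul F G ihF ihG => exact ⟨ihF hE.1, ihG hE.2⟩
  | star F ih =>
    have hF : Starrable (value F) := by
      rw [value_eq_C_add_eval_deriv hE.1]
      exact starrable_C_add hE.2 (eval_deriv_mem_vanishingBelow_one F)
    exact ⟨ih hE.1, starrable_of.1 hF⟩

end Expr

namespace Automaton.Represents

variable {Q : Type*} [Fintype Q] {A : Automaton K M Q} {E : Expr K M} {f : Q → Expr K M}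

theorem value_eq [IsStrongSemiring K] (hA : A.Represents E f) (hf : ∀ p, (f p).Valid) :
    (fun p => (f p).value) =
      (fun p => C (A.final p)) + A.seriesTrans.mulVec (fun p => (f p).value) := by
  funext p
  rw [Expr.value_eq_C_add_eval_deriv (hf p), ← hA.final, ← hA.trans, Expr.eval_formalSum]
  rfl

theorem behaviour_eq [IsStrongSemiring K] (hA : A.Represents E f) (hf : ∀ p, (f p).Valid) :
    A.behaviour = E.series := by
  funext m
  calc A.behaviour m
      = ∑ p, A.init p * ∑ q, A.transStar p q m * A.final q := by
        simp only [behaviour, Finset.mul_sum, mul_assoc]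
    _ = ∑ p, A.init p * coeff m (f p).value := by
        simp only [sum_transStar_mul_final (hA.value_eq hf)]
    _ = E.series m := hA.sum_init_mul fun H => coeff m H.value

end Automaton.Represents

theorem Expr.Valid.behaviour_derivedTermAutomaton [IsStrongSemiring K] {E : Expr K M}
    (hE : E.Valid) : E.derivedTermAutomaton.behaviour = E.series := by
  refine (derivedTermAutomaton_represents E).behaviour_eq fun H => ?_
  classical
  obtain ⟨H, hH⟩ := H
  obtain rfl | hH := Finset.mem_insert.1 hH
  · exact hE
  · exact hE.of_mem_derTerms hH

end Semantics

end WExpr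

end

theorem theoremt {K : Type*} [Semiring K] [TopologicalSpace K] [WExpr.IsStrongSemiring K]
    {M : Type*} [Monoid M] [WExpr.IsGradedMonoid M]
    (E : WExpr.Expr K M) (hE : E.Valid) :
    E.derivedTermAutomaton.IsQuotient E.positionAutomaton ∧
    (E.SeriesDefined ∧ E.derivedTermAutomaton.behaviour = E.series) ∧
    E.termAutomaton.IsMorphism E.derivedTermAutomaton E.omega ∧
    (E ∈ E.derTerms → ∀ p q, p ≠ q →
      (E.omega p = E.omega q ↔
        (p = Sum.inl () ∧ ∃ h, q = Sum.inr ⟨E, h⟩) ∨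
        (q = Sum.inl () ∧ ∃ h, p = Sum.inr ⟨E, h⟩))) ∧
    (E ∉ E.derTerms → Function.Bijective E.omega) :=
  ⟨E.derivedTermAutomaton_isQuotient, ⟨hE.seriesDefined, hE.behaviour_derivedTermAutomaton⟩,
    E.omega_isMorphism, fun _ _ _ => E.omega_eq_iff, WExpr.Expr.omega_bijective⟩
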